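/- Let $\mathcal L$ be a first-order language and let $\mathfrak C$ be a monster model of a complete $\mathcal L$-theory with infinite models, i.e. $\mathfrak C$ is an infinite $\mathcal L$-structure which is $\kappa$-saturated and strongly $\kappa$-homogeneous for some cardinal $\kappa$. Let $M\preceq\mathfrak C$ be small, i.e. $|M|<\kappa$, and let $\bar m$ be an enumeration of $M$. Let $\mathfrak C'\succeq\mathfrak C$ be a bigger monster model in which $\mathfrak C$ is small, i.e. $\mathfrak C'$ is $\kappa'$-saturated and strongly $\kappa'$-homogeneous for some $\kappa'>|\mathfrak C|$. Let $\bar x$ and $\bar y$ be tuples of variables corresponding to $\bar m$. Let $S_{\bar m}(\mathfrak C)$ be the set of complete types over $\mathfrak C$ in the variables $\bar y$ which contain $\mathrm{tp}(\bar m/\emptyset)$, and let $S^{\mathrm{inv}}_{\bar m}(\mathfrak C,M)$ be the set of those $p\in S_{\bar m}(\mathfrak C)$ which are $M$-invariant: for every $\mathcal L$-formula $\varphi(\bar z;\bar y)$ and all tuples $\bar a,\bar b$ from $\mathfrak C$ with $\mathrm{tp}(\bar a/M)=\mathrm{tp}(\bar b/M)$, one has $\varphi(\bar a;\bar y)\in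 p$ if and only if $\varphi(\bar b;\bar y)\in p$. For $\bar b\in\mathfrak C^{\bar x}$ let $h_{\bar b}\colon S_{\bar m}(\mathfrak C)\to S_{\bar x}(M)$ be the (well-defined) map $\mathrm{tp}(\sigma(\bar m)/\mathfrak C)\mapsto\mathrm{tp}(\sigma^{-1}(\bar b)/M)$, $\sigma\in\mathrm{Aut}(\mathfrak C')$. For $p,q\in S^{\mathrm{inv}}_{\bar m}(\mathfrak C,M)$, the product $p*q$ is defined as follows: for every $\mathcal L$-formula $\varphi(\bar x;\bar y)$ and every $\bar b\in\mathfrak C^{\bar x}$, $$\varphi(\bar b;\bar y)\in p*q\iff\varphi(\bar x;\bar y)\in p_{\bar y}\otimes (h_{\bar b}(q))_{\bar x},$$ where $\otimes$ is the Morley product, i.e. the right-hand side means that $\varphi(\bar a;\bar y)\in p$ for some (equivalently, every) $\bar a\in\mathfrak C^{\bar x}$ realizing $h_{\bar b}(q)$. Then: 1. $S^{\mathrm{inv}}_{\bar m}(\mathfrak C,M)$ is closed under $*$: if $p,q\in S^{\mathrm{inv}}_{\bar m}(\mathfrak C,M)$, then $p*q\in S^{\mathrm{inv}}_{\bar m}(\mathfrak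 C,M)$. 2. For all $p,q,r\in S^{\mathrm{inv}}_{\bar m}(\mathfrak C,M)$ we have $(p*q)*r=p*(q*r)$. (No NIP and no definability assumption is made.) -/

import Mathlib

open FirstOrder Cardinal

universe u v w x y z

namespace StarProduct

section Basic

variable {L : FirstOrder.Language.{u, v}}

/-- For a set `A` of parameters, an `L_Y(A)`-formula, i.e. a formula with free variables among `Y`
and parameters from `A`, is represented by an `L`-formula with free variables in `A ⊕ Y`, where the
variables from the left summand stand for the parameters themselves. -/
abbrev ParamFormula (L : FirstOrder.Language.{u, v}) (A : Type w) (Y : Type x) : Type (max u v w x) :=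
  L.Formula (A ⊕ Y)

/-- `C` is `κ`-saturated: every set of formulas in one variable over a set `A ⊆ C` of
cardinality less than `κ` which is finitely satisfiable in `C` is realized in `C`. -/
def IsSaturated (L : FirstOrder.Language.{u, v}) (C : Type w) [L.Structure C] (κ : Cardinal.{w}) : Prop :=
  ∀ A : Set C, #A < κ → ∀ Γ : Set (ParamFormula L A Unit),
    (∀ s : Finset (ParamFormula L A Unit), (s : Set _) ⊆ Γ →
      ∃ c : C, ∀ φ ∈ s, φ.Realize (Sum.elim (fun a : A => (a : C)) fun _ => c)) →
    ∃ c : C, ∀ φ ∈ Γ, φ.Realize (Sum.elim (fun a : A => (a : C)) fun _ => c)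

/-- `C` is strongly `κ`-homogeneous: every partial elementary map from a subset of `C` of
cardinality less than `κ` to `C` extends to an automorphism of `C`. -/
def IsStronglyHomogeneous (L : FirstOrder.Language.{u, v}) (C : Type w) [L.Structure C]
    (κ : Cardinal.{w}) : Prop :=
  ∀ A : Set C, #A < κ → ∀ f : A → C,
    (∀ φ : L.Formula A, φ.Realize (fun a : A => (a : C)) ↔ φ.Realize f) →
    ∃ σ : C ≃[L] C, ∀ a : A, σ a = f a

/-- A monster model, with degree of saturation and homogeneity `κ`. -/
structure IsMonster (L : FirstOrder.Language.{u, v}) (C : Type w) [L.Structure C]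
    (κ : Cardinal.{w}) : Prop where
  saturated : IsSaturated L C κ
  homogeneous : IsStronglyHomogeneous L C κ

/-- The complete type `tp(a/A)` of a tuple `a` in a structure `N`, where the parameters from `A`
are interpreted in `N` through `e` (in practice, an inclusion `A ⊆ N`). -/
def tp {A : Type w} {N : Type x} {Y : Type y} [L.Structure N] (e : A → N) (a : Y → N) :
    Set (ParamFormula L A Y) :=
  {φ | φ.Realize (Sum.elim e a)}

/-- The formula `φ(b; y)` over `C`, for an `L`-formula `φ(x; y)` and a tuple `b` from `C`. -/
def inst {C : Type w} {X : Type x} {Y : Type y} (φ : L.Formula (X ⊕ Y)) (b : X → C) :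
    ParamFormula L C Y :=
  φ.relabel (Sum.map b id)

end Basic

section Types

variable {L : FirstOrder.Language.{u, v}} {C : Type w} [L.Structure C]

/-- `S_Y(C)`: complete types over `C` in the variables `Y`. -/
structure IsCompleteType {Y : Type x} (p : Set (ParamFormula L C Y)) : Prop where
  finitelySatisfiable : ∀ s : Finset (ParamFormula L C Y), (s : Set _) ⊆ p →
    ∃ v : Y → C, ∀ φ ∈ s, φ.Realize (Sum.elim id v)
  complete : ∀ φ : ParamFormula L C Y, φ ∈ p ∨ φ.not ∈ p

/-- `p` is invariant over `M`: for every `L`-formula `φ(z; y)` and tuples `a`, `b` from `C` with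
`tp(a/M) = tp(b/M)`, we have `φ(a; y) ∈ p` if and only if `φ(b; y) ∈ p`. -/
def IsInvariant (M : L.ElementarySubstructure C) {Y : Type x}
    (p : Set (ParamFormula L C Y)) : Prop :=
  ∀ (n : ℕ) (φ : L.Formula (Fin n ⊕ Y)) (a b : Fin n → C),
    tp (L := L) (fun m : M => (m : C)) a = tp (L := L) (fun m : M => (m : C)) b →
    (inst φ a ∈ p ↔ inst φ b ∈ p)

variable {M : L.ElementarySubstructure C} {I : Type x}

/-- The tuple of elements of `C` given by an enumeration of `M`. -/
def tuple (m : I ≃ M) : I → C := fun i => (m i : C)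

/-- `S_m(C)`: complete types over `C` which contain `tp(m/∅)`. -/
def typesAt (m : I ≃ M) : Set (Set (ParamFormula L C I)) :=
  {p | IsCompleteType p ∧
    ∀ φ : L.Formula I, φ.Realize (tuple m) → φ.relabel (Sum.inr : I → C ⊕ I) ∈ p}

/-- `S_m^inv(C, M)`: complete types over `C` which contain `tp(m/∅)` and are invariant
over `M`. -/
def invTypesAt (m : I ≃ M) : Set (Set (ParamFormula L C I)) :=
  {p | p ∈ typesAt m ∧ IsInvariant M p}

variable {C' : Type y} [L.Structure C']

/-- The map `h_b : S_m(C) → S_x(M)`, `tp(σ(m)/C) ↦ tp(σ⁻¹(b)/M)` for `σ ∈ Aut(C')`, where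
`ι : C → C'` is the inclusion. As the value does not depend on the choice of `σ`, it is written as
the union over all such `σ`. -/
def h (ι : C ↪ₑ[L] C') (m : I ≃ M) {X : Type z} (b : X → C) (q : Set (ParamFormula L C I)) :
    Set (ParamFormula L M X) :=
  {θ | ∃ σ : C' ≃[L] C', q = tp ι (fun i => σ (ι (tuple m i))) ∧
    θ ∈ tp (fun a : M => ι (a : C)) (fun j => σ.symm (ι (b j)))}

/-- The Morley product `p_y ⊗ q_x` of an `M`-invariant type `p` over `C` with a type `q` over `M`:
an `L(M)`-formula `φ(x; y)` belongs to it if and only if `φ(a; y) ∈ p`, where `a` is a tuple in `C`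
realizing `q`. -/
def morley {X : Type z} (p : Set (ParamFormula L C I)) (q : Set (ParamFormula L M X)) :
    Set (ParamFormula L M (X ⊕ I)) :=
  {φ | ∃ a : X → C, tp (L := L) (fun c : M => (c : C)) a = q ∧
    φ.relabel (Sum.elim (fun c : M => Sum.inl (c : C)) (Sum.map a id)) ∈ p}

/-- The product `p * q`: for an `L`-formula `φ(x; y)` and a tuple `b` from `C`, where `x` and `y`
correspond to the enumeration `m`, we have `φ(b; y) ∈ p * q` if and only if
`φ(x; y) ∈ p_y ⊗ (h_b(q))_x`. Formulas over `C` which define the same set are identified. -/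
def star (ι : C ↪ₑ[L] C') (m : I ≃ M) (p q : Set (ParamFormula L C I)) :
    Set (ParamFormula L C I) :=
  {ψ | ∃ (φ : L.Formula (I ⊕ I)) (b : I → C),
    (∀ v : I → C, ψ.Realize (Sum.elim id v) ↔ (inst φ b).Realize (Sum.elim id v)) ∧
    φ.relabel (Sum.inr : I ⊕ I → M ⊕ (I ⊕ I)) ∈ morley p (h ι m b q)}

end Types

end StarProduct

/-!
Let `q = tp(σ(m)/C)` with `σ ∈ Aut(C')`. A tuple `a` from `C` realizes `h_b(q) = tp(σ⁻¹(b)/M)` if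
and only if `(a, m)` and `(b, σ(m))` have the same type over `∅`; call `a` a `q`-shadow of `b` in
this case. Small tuples have shadows by saturation, and all shadows of `b` have the same type over
`M`, so for invariant `p` the condition `φ(b; y) ∈ p * q` means `φ(a; y) ∈ p` for any shadow `a` of
`b`. A shadow of a joint tuple `(b, b')` shows that this depends only on the set defined by
`φ(b; y)`. Since `a` and `b` have the same type over `∅`, consistency and completeness pass from `p`
to `p * q`; if `q` is invariant, tuples with the same type over `M` have the same `q`-shadows, so
`p * q` is invariant.

Shadows compose: if `a` is an `r`-shadow of `b` and `c` is a `q`-shadow of `a`, then `c` is a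
`(q * r)`-shadow of `b`. Hence `φ(b; y)` belongs to `(p * q) * r`, and likewise to `p * (q * r)`, if
and only if `φ(c; y) ∈ p`.
-/

namespace StarProduct

open FirstOrder.Language

section Formulas

variable {L : FirstOrder.Language.{u, v}} {N : Type w} [L.Structure N] {α : Type x} {β : Type y}

theorem realize_iff_of_eqOn_freeVarFinset [DecidableEq α] {φ : L.Formula α} {v v' : α → N}
    (hv : Set.EqOn v v' φ.freeVarFinset) : φ.Realize v ↔ φ.Realize v' :=
  (BoundedFormula.realize_restrictFreeVar (f := id) (v := fun a => v a) v fun _ => rfl).symm.trans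
    (BoundedFormula.realize_restrictFreeVar (f := id) v' fun a => hv a.2)

theorem realize_relabel_sumMap_iff [DecidableEq α] [DecidableEq β] {γ : Type z}
    {φ : L.Formula (α ⊕ β)} {e : γ → α} {g : α → γ}
    (heg : ∀ i ∈ φ.freeVarFinset.toLeft, e (g i) = i) (a : α → N) (v : β → N) :
    (φ.relabel (Sum.map g id)).Realize (Sum.elim (a ∘ e) v) ↔ φ.Realize (Sum.elim a v) := by
  rw [Formula.realize_relabel, Sum.elim_comp_map]
  refine realize_iff_of_eqOn_freeVarFinset ?_
  rintro (i | j) hi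
  · exact congrArg a (heg i (Finset.mem_toLeft.2 hi))
  · rfl

open Classical in
/-- Existential quantification over the right-hand variables of a formula. There may be infinitely
many of them, but only those which occur in the formula need to be quantified. -/
noncomputable def exsRight (φ : L.Formula (α ⊕ β)) : L.Formula α :=
  Formula.iExs φ.freeVarFinset (φ.restrictFreeVar fun i => Sum.map id (fun _ => i) i.1)

@[simp]
theorem realize_exsRight [Nonempty N] {φ : L.Formula (α ⊕ β)} {a : α → N} :
    (exsRight φ).Realize a ↔ ∃ b : β → N, φ.Realize (Sum.elim a b) := by
  classical
  rw [exsRight, Formula.realize_iExs]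
  constructor
  · rintro ⟨b, hb⟩
    refine ⟨fun j => if hj : Sum.inr j ∈ φ.freeVarFinset then b ⟨_, hj⟩
      else Classical.arbitrary N, (BoundedFormula.realize_restrictFreeVar _ ?_).1 hb⟩
    rintro ⟨i | j, hj⟩
    · rfl
    · simp [hj]
  · rintro ⟨b, hb⟩
    refine ⟨fun i => Sum.elim a b i, (BoundedFormula.realize_restrictFreeVar _ ?_).2 hb⟩
    rintro ⟨i | j, hj⟩ <;> rfl

@[simp]
theorem realize_inst {φ : L.Formula (α ⊕ β)} {b : α → N} {v : β → N} :
    (inst φ b).Realize (Sum.elim id v) ↔ φ.Realize (Sum.elim b v) := by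
  rw [inst, Formula.realize_relabel, Sum.elim_comp_map, Function.id_comp, Function.comp_id]

theorem inst_not {C : Type w} (φ : L.Formula (α ⊕ β)) (b : α → C) :
    inst φ.not b = (inst φ b).not :=
  BoundedFormula.relabel_not _ φ

theorem exists_realize_inst_iff [Infinite α] [Nonempty N] (s : Finset (ParamFormula L N β)) :
    ∃ (b : α → N) (φ : ParamFormula L N β → L.Formula (α ⊕ β)), ∀ ψ ∈ s, ∀ v : β → N,
      ψ.Realize (Sum.elim id v) ↔ (inst (φ ψ) b).Realize (Sum.elim id v) := by
  classical
  let F : Finset N := s.biUnion fun ψ => ψ.freeVarFinset.toLeft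
  obtain ⟨g, -, hg⟩ := F.finite_toSet.exists_injOn_of_encard_le
    (t := (Set.univ : Set α)) (by simp)
  refine ⟨Function.invFunOn g F, fun ψ => ψ.relabel (Sum.map g id), fun ψ hψ v => ?_⟩
  rw [realize_inst]
  exact (realize_relabel_sumMap_iff
    (fun c hc => hg.leftInvOn_invFunOn (Finset.mem_biUnion.2 ⟨ψ, hψ, hc⟩)) id v).symm

end Formulas

section Saturation

variable {L : FirstOrder.Language.{u, v}} {N : Type w} [L.Structure N] {V : Type x}

/-- The assignments `V → N` which satisfy all formulas in `Γ` and extend the partial assignment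
with graph `S`. -/
def solutions (Γ : Set (L.Formula V)) (S : Set (V × N)) : Set (V → N) :=
  {v | (∀ φ ∈ Γ, φ.Realize v) ∧ ∀ z ∈ S, v z.1 = z.2}

/-- Finite satisfiability of `Γ` together with the partial assignment with graph `S`. It forces
`S` to be the graph of a partial function. -/
def IsFinSatWith (Γ : Set (L.Formula V)) (S : Set (V × N)) : Prop :=
  ∀ (s : Finset (L.Formula V)) (t : Finset (V × N)), (s : Set _) ⊆ Γ → (t : Set _) ⊆ S →
    (solutions (s : Set (L.Formula V)) (t : Set (V × N))).Nonempty

variable {Γ : Set (L.Formula V)} {S : Set (V × N)}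

theorem IsFinSatWith.snd_eq_snd (hS : IsFinSatWith Γ S) {y : V} {c d : N} (hc : (y, c) ∈ S)
    (hd : (y, d) ∈ S) : c = d := by
  classical
  obtain ⟨v, -, hv⟩ := hS ∅ {(y, c), (y, d)} (by simp) (by simp [Set.insert_subset_iff, hc, hd])
  exact (hv (y, c) (by simp)).symm.trans (hv (y, d) (by simp))

theorem IsFinSatWith.hasCardinalLT_snd_image (hS : IsFinSatWith Γ S) {κ : Cardinal.{z}}
    (hV : HasCardinalLT V κ) : HasCardinalLT (Prod.snd '' S) κ := by
  have exists_var : ∀ a : Prod.snd '' S, ∃ y : V, (y, (a : N)) ∈ S := by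
    rintro ⟨_, ⟨y, c⟩, hz, rfl⟩
    exact ⟨y, hz⟩
  choose g hg using exists_var
  exact hV.of_injective g fun a b hab => Subtype.ext (hS.snd_eq_snd (hg a) (hab ▸ hg b))

theorem exists_realize_iff_exists_mem_solutions [Nonempty N] (s : Finset (L.Formula V))
    (t : Finset (V × N)) (x : V) {A : Set N} (ht : ∀ z ∈ t, z.2 ∈ A) :
    ∃ χ : ParamFormula L A Unit, ∀ c : N,
      χ.Realize (Sum.elim (fun a : A => (a : N)) fun _ => c) ↔
        ∃ v ∈ solutions (s : Set (L.Formula V)) (t : Set (V × N)), v x = c := by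
  let var : (A ⊕ Unit) ⊕ V → L.Term ((A ⊕ Unit) ⊕ V) := Term.var
  let satisfies : L.Formula ((A ⊕ Unit) ⊕ V) :=
    Formula.iInf fun φ : s => (φ : L.Formula V).relabel Sum.inr
  let extends_t : L.Formula ((A ⊕ Unit) ⊕ V) :=
    Formula.iInf fun z : t => (var (.inr z.1.1)).equal (var (.inl (.inl ⟨z.1.2, ht z z.2⟩)))
  let takes_value : L.Formula ((A ⊕ Unit) ⊕ V) := (var (.inr x)).equal (var (.inl (.inr ())))
  refine ⟨exsRight (satisfies ⊓ extends_t ⊓ takes_value), fun c => ?_⟩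
  simp [satisfies, extends_t, takes_value, var, solutions, Formula.realize_equal, -Prod.forall]

theorem IsFinSatWith.exists_insert [Nonempty N] {κ : Cardinal.{w}} (hN : IsSaturated L N κ)
    (hV : HasCardinalLT V κ) (hS : IsFinSatWith Γ S) (x : V) :
    ∃ c : N, IsFinSatWith Γ (insert (x, c) S) := by
  classical
  let A : Set N := Prod.snd '' S
  have hA : #A < κ := (hasCardinalLT_iff_cardinal_mk_lt A κ).1 (hS.hasCardinalLT_snd_image hV)
  let Δ : Set (ParamFormula L A Unit) := {χ | ∃ (s : Finset (L.Formula V)) (t : Finset (V × N)),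
    (s : Set _) ⊆ Γ ∧ (t : Set _) ⊆ S ∧
    ∀ v ∈ solutions (s : Set (L.Formula V)) (t : Set (V × N)),
      χ.Realize (Sum.elim (fun a : A => (a : N)) fun _ => v x)}
  obtain ⟨c, hc⟩ : ∃ c : N, ∀ χ ∈ Δ, χ.Realize (Sum.elim (fun a : A => (a : N)) fun _ => c) := by
    refine hN A hA Δ fun Δ₀ hΔ₀ => ?_
    choose! s t hs ht hst using fun χ (hχ : χ ∈ Δ₀) => hΔ₀ hχ
    obtain ⟨v, hvs, hvt⟩ := hS (Δ₀.biUnion s) (Δ₀.biUnion t)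
      (by simpa using hs) (by simpa using ht)
    exact ⟨v x, fun χ hχ => hst χ hχ v ⟨fun φ hφ => hvs φ (Finset.mem_biUnion.2 ⟨χ, hχ, hφ⟩),
      fun z hz => hvt z (Finset.mem_biUnion.2 ⟨χ, hχ, hz⟩)⟩⟩
  refine ⟨c, fun s t hs ht => ?_⟩
  have htS : ∀ z ∈ t.filter (· ∈ S), z ∈ S := fun z hz => (Finset.mem_filter.1 hz).2
  obtain ⟨χ, hχ⟩ := exists_realize_iff_exists_mem_solutions s (t.filter (· ∈ S)) x (A := A)
    fun z hz => ⟨z, htS z hz, rfl⟩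
  obtain ⟨v, ⟨hvs, hvt⟩, hvx⟩ := (hχ c).1
    (hc χ ⟨s, _, hs, htS, fun v hv => (hχ _).2 ⟨v, hv, rfl⟩⟩)
  refine ⟨v, hvs, fun z hz => ?_⟩
  rcases ht hz with rfl | hzS
  · exact hvx
  · exact hvt z (Finset.mem_filter.2 ⟨hz, hzS⟩)

theorem IsFinSatWith.sUnion {c : Set (Set (V × N))} (hc : ∀ S ∈ c, IsFinSatWith Γ S)
    (hchain : IsChain (· ⊆ ·) c) (hne : c.Nonempty) : IsFinSatWith Γ (⋃₀ c) := by
  intro s t hs ht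
  obtain ⟨S, hSc, htS⟩ := hchain.directedOn.exists_mem_subset_of_finite_of_subset_sUnion hne
    t.finite_toSet ht
  exact hc S hSc s t hs htS

theorem IsFinSatWith.mem_solutions (hS : IsFinSatWith Γ S) {v : V → N} (hv : ∀ x, (x, v x) ∈ S) :
    v ∈ solutions Γ S := by
  classical
  refine ⟨fun φ hφ => ?_, fun z hz => hS.snd_eq_snd (hv z.1) hz⟩
  obtain ⟨v', hφv', hv'⟩ := hS {φ} (φ.freeVarFinset.image fun x => (x, v x)) (by simpa using hφ)
    (by simpa [Set.subset_def] using fun x _ => hv x)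
  have hvv' : Set.EqOn v' v φ.freeVarFinset := fun x hx =>
    hv' (x, v x) (Finset.mem_image_of_mem _ hx)
  exact (realize_iff_of_eqOn_freeVarFinset hvv').1 (hφv' φ (Finset.mem_singleton_self φ))

theorem IsFinSatWith.solutions_nonempty [Nonempty N] {κ : Cardinal.{w}} (hN : IsSaturated L N κ)
    (hV : HasCardinalLT V κ) (hS : IsFinSatWith Γ S) : (solutions Γ S).Nonempty := by
  obtain ⟨T, hST, hT⟩ := zorn_subset_nonempty {S : Set (V × N) | IsFinSatWith Γ S}
    (fun c hc hchain hne => ⟨⋃₀ c, .sUnion hc hchain hne, fun _ => Set.subset_sUnion_of_mem⟩) S hS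
  have total : ∀ x : V, ∃ c : N, (x, c) ∈ T := fun x => by
    obtain ⟨c, hc⟩ := hT.prop.exists_insert hN hV x
    exact ⟨c, hT.le_of_ge hc (Set.subset_insert _ _) (Set.mem_insert _ _)⟩
  choose v hv using total
  have hvT := hT.prop.mem_solutions hv
  exact ⟨v, hvT.1, fun z hz => hvT.2 z (hST hz)⟩

theorem IsSaturated.exists_forall_realize [Nonempty N] {κ : Cardinal.{w}} (hN : IsSaturated L N κ)
    {A : Type x} {Y : Type y} (hAY : HasCardinalLT (A ⊕ Y) κ) (e : A → N)
    {Γ : Set (ParamFormula L A Y)}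
    (hΓ : ∀ s : Finset (ParamFormula L A Y), (s : Set _) ⊆ Γ →
      ∃ v : Y → N, ∀ φ ∈ s, φ.Realize (Sum.elim e v)) :
    ∃ v : Y → N, ∀ φ ∈ Γ, φ.Realize (Sum.elim e v) := by
  have hS : IsFinSatWith Γ (Set.range fun a : A => (Sum.inl a, e a)) := fun s t hs ht => by
    obtain ⟨v, hv⟩ := hΓ s hs
    refine ⟨Sum.elim e v, hv, fun z hz => ?_⟩
    obtain ⟨a, rfl⟩ := ht hz
    rfl
  obtain ⟨v, hvΓ, hve⟩ := hS.solutions_nonempty hN hAY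
  have hv : v = Sum.elim e (v ∘ Sum.inr) := by
    rw [← Sum.elim_comp_inl_inr v]
    exact congrArg (Sum.elim · _) (funext fun a => hve _ ⟨a, rfl⟩)
  exact ⟨v ∘ Sum.inr, fun φ hφ => hv ▸ hvΓ φ hφ⟩

end Saturation

section CompleteTypes

variable {L : FirstOrder.Language.{u, v}} {C : Type w} [L.Structure C] {Y : Type x}
  {p q : Set (ParamFormula L C Y)}

theorem IsCompleteType.not_mem_iff (hp : IsCompleteType p) {φ : ParamFormula L C Y} :
    φ.not ∈ p ↔ φ ∉ p := by
  classical
  refine ⟨fun hn hφ => ?_, fun hφ => (hp.complete φ).resolve_left hφ⟩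
  obtain ⟨v, hv⟩ := hp.finitelySatisfiable {φ, φ.not} (by simp [Set.insert_subset_iff, hφ, hn])
  exact Formula.realize_not.1 (hv φ.not (by simp)) (hv φ (by simp))

theorem IsCompleteType.mem_of_forall_realize (hp : IsCompleteType p)
    {s : Finset (ParamFormula L C Y)} (hs : (s : Set _) ⊆ p) {ψ : ParamFormula L C Y}
    (hψ : ∀ v : Y → C, (∀ φ ∈ s, φ.Realize (Sum.elim id v)) → ψ.Realize (Sum.elim id v)) :
    ψ ∈ p := by
  classical
  by_contra hnot
  obtain ⟨v, hv⟩ := hp.finitelySatisfiable (insert ψ.not s) (by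
    rw [Finset.coe_insert]
    exact Set.insert_subset (hp.not_mem_iff.2 hnot) hs)
  exact Formula.realize_not.1 (hv _ (Finset.mem_insert_self _ _))
    (hψ v fun φ hφ => hv φ (Finset.mem_insert_of_mem hφ))

theorem IsCompleteType.mem_congr (hp : IsCompleteType p) {φ ψ : ParamFormula L C Y}
    (hφψ : ∀ v : Y → C, φ.Realize (Sum.elim id v) ↔ ψ.Realize (Sum.elim id v)) :
    φ ∈ p ↔ ψ ∈ p :=
  ⟨fun hφ => hp.mem_of_forall_realize (s := {φ}) (by simpa using hφ)
      fun v hv => (hφψ v).1 (hv φ (by simp)),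
    fun hψ => hp.mem_of_forall_realize (s := {ψ}) (by simpa using hψ)
      fun v hv => (hφψ v).2 (hv ψ (by simp))⟩

theorem IsCompleteType.inst_relabel_inl_mem_iff (hp : IsCompleteType p) {X : Type y}
    {χ : L.Formula X} {b : X → C} : inst (χ.relabel Sum.inl) b ∈ p ↔ χ.Realize b := by
  have realize_iff : ∀ v : Y → C,
      (inst (χ.relabel Sum.inl) b).Realize (Sum.elim id v) ↔ χ.Realize b := fun v => by
    rw [realize_inst, Formula.realize_relabel, Sum.elim_comp_inl]
  refine ⟨fun hχ => ?_, fun hχ => ?_⟩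
  · obtain ⟨v, hv⟩ := hp.finitelySatisfiable {_} (by simpa using hχ)
    exact (realize_iff v).1 (hv _ (Finset.mem_singleton_self _))
  · exact hp.mem_of_forall_realize (s := ∅) (by simp) fun v _ => (realize_iff v).2 hχ

theorem IsInvariant.inst_mem_iff {M : L.ElementarySubstructure C} (hinv : IsInvariant M p)
    (hp : IsCompleteType p) {X : Type y} {φ : L.Formula (X ⊕ Y)} {a b : X → C}
    (hab : tp (L := L) (fun c : M => (c : C)) a = tp (L := L) (fun c : M => (c : C)) b) :
    inst φ a ∈ p ↔ inst φ b ∈ p := by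
  classical
  rcases isEmpty_or_nonempty X with _ | ⟨⟨x₀⟩⟩
  · rw [Subsingleton.elim a b]
  let F : Finset X := insert x₀ φ.freeVarFinset.toLeft
  let e : Fin F.card → X := fun i => F.equivFin.symm i
  have : Nonempty (Fin F.card) := ⟨F.equivFin ⟨x₀, Finset.mem_insert_self _ _⟩⟩
  have right_inv : ∀ i ∈ φ.freeVarFinset.toLeft, e (Function.invFun e i) = i := fun i hi =>
    Function.invFun_eq ⟨F.equivFin ⟨i, Finset.mem_insert_of_mem hi⟩, by simp [e]⟩
  have inst_comp_mem : ∀ c : X → C,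
      inst (φ.relabel (Sum.map (Function.invFun e) id)) (c ∘ e) ∈ p ↔ inst φ c ∈ p := fun c =>
    hp.mem_congr fun v => by
      rw [realize_inst, realize_inst, realize_relabel_sumMap_iff right_inv]
  rw [← inst_comp_mem a, ← inst_comp_mem b]
  refine hinv _ _ _ _ (Set.ext fun θ => ?_)
  simpa [tp, Formula.realize_relabel, Sum.elim_comp_map] using
    Set.ext_iff.1 hab (θ.relabel (Sum.map id e))

theorem relabel_inr_mem_iff_of_mem_typesAt {M : L.ElementarySubstructure C} {m : Y ≃ M}
    (hq : q ∈ typesAt m) {φ : L.Formula Y} :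
    φ.relabel (Sum.inr : Y → C ⊕ Y) ∈ q ↔ φ.Realize (tuple m) := by
  refine ⟨fun hφ => ?_, hq.2 φ⟩
  by_contra hn
  exact hq.1.not_mem_iff.1 (hq.2 φ.not (Formula.realize_not.2 hn)) hφ

end CompleteTypes

section Conjugates

variable {L : FirstOrder.Language.{u, v}} {C : Type w} [L.Structure C]

theorem aleph0_le_of_hasCardinalLT {X : Type x} [Infinite X] {κ : Cardinal.{w}}
    (hX : HasCardinalLT X κ) : ℵ₀ ≤ κ := by
  by_contra! hκ
  exact not_finite_iff_infinite.2 ‹_› ((hasCardinalLT_aleph0_iff X).1 (hX.of_le hκ.le))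

theorem IsStronglyHomogeneous.exists_equiv {κ : Cardinal.{w}} (hC : IsStronglyHomogeneous L C κ)
    {Y : Type x} (hY : HasCardinalLT Y κ) {a b : Y → C}
    (hab : ∀ φ : L.Formula Y, φ.Realize a ↔ φ.Realize b) :
    ∃ σ : C ≃[L] C, ∀ i, σ (a i) = b i := by
  let s : Set.range a → Y := Set.rangeSplitting a
  have eq_of_eq : ∀ i j, a i = a j → b i = b j := fun i j hij => by
    simpa [Formula.realize_equal] using
      (hab ((Term.var i).equal (Term.var j))).1 (by simpa [Formula.realize_equal] using hij)
  have hrange : #(Set.range a) < κ := (hasCardinalLT_iff_cardinal_mk_lt _ κ).1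
    (hY.of_surjective _ Set.rangeFactorization_surjective)
  obtain ⟨σ, hσ⟩ := hC (Set.range a) hrange (b ∘ s) fun φ => by
    rw [← Set.comp_rangeSplitting a, ← Formula.realize_relabel, ← Formula.realize_relabel]
    exact hab _
  exact ⟨σ, fun i => (hσ ⟨a i, i, rfl⟩).trans (eq_of_eq _ _ (Set.apply_rangeSplitting a _))⟩

variable {C' : Type y} [L.Structure C']

theorem IsCompleteType.exists_eq_tp [Nonempty C'] {Y : Type x} {p : Set (ParamFormula L C Y)}
    (hp : IsCompleteType p) {κ' : Cardinal.{y}} (hC' : IsSaturated L C' κ') (ι : C ↪ₑ[L] C')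
    (hCY : HasCardinalLT (C ⊕ Y) κ') : ∃ a : Y → C', p = tp ι a := by
  obtain ⟨a, ha⟩ := hC'.exists_forall_realize hCY ι (Γ := p) fun s hs => by
    obtain ⟨v, hv⟩ := hp.finitelySatisfiable s hs
    refine ⟨ι ∘ v, fun φ hφ => ?_⟩
    have hφv := (ι.map_formula φ _).2 (hv φ hφ)
    rwa [Sum.comp_elim, Function.comp_id] at hφv
  refine ⟨a, Set.Subset.antisymm ha fun φ hφ => ?_⟩
  by_contra hn
  exact Formula.realize_not.1 (ha _ (hp.not_mem_iff.2 hn)) hφ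

variable {M : L.ElementarySubstructure C} {I : Type x}

/-- Every type in `S_m(C)` is the type over `C` of a conjugate of `m` in `C'`. This is what makes
the maps `h_b` total on `S_m(C)`. -/
def HasConjugates (ι : C ↪ₑ[L] C') (m : I ≃ M) : Prop :=
  ∀ q ∈ typesAt m, ∃ σ : C' ≃[L] C', q = tp ι (fun i => σ (ι (tuple m i)))

theorem IsMonster.hasConjugates [Infinite C] {κ' : Cardinal.{y}} (hC' : IsMonster L C' κ')
    (ι : C ↪ₑ[L] C') (hC : HasCardinalLT C κ') (m : I ≃ M) : HasConjugates ι m := by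
  intro q hq
  have : Nonempty C' := ⟨ι (Classical.arbitrary C)⟩
  have hI : HasCardinalLT I κ' :=
    hC.of_injective (tuple m) (Subtype.val_injective.comp m.injective)
  obtain ⟨a, rfl⟩ := hq.1.exists_eq_tp hC'.saturated ι
    ((hasCardinalLT_sum_iff C I κ' (aleph0_le_of_hasCardinalLT hC)).2 ⟨hC, hI⟩)
  obtain ⟨σ, hσ⟩ := hC'.homogeneous.exists_equiv hI (a := ι ∘ tuple m) (b := a) fun φ => by
    rw [ι.map_formula, ← relabel_inr_mem_iff_of_mem_typesAt hq]
    simp [tp, Formula.realize_relabel]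
  exact ⟨σ, congrArg _ (funext fun i => (hσ i).symm)⟩

end Conjugates

section Shadows

variable {L : FirstOrder.Language.{u, v}} {C : Type w} [L.Structure C]
  {M : L.ElementarySubstructure C} {I : Type x} {m : I ≃ M} {p q : Set (ParamFormula L C I)}
  {X : Type z}

/-- The tuple `a` realizes the type `h_b(q)` over `M`. If `q = tp(σ(m)/C)`, this says that
`(a, m)` and `(σ⁻¹(b), m)`, equivalently `(a, m)` and `(b, σ(m))`, have the same type over `∅`; in
the latter form it does not mention `σ`. -/
def IsShadow (m : I ≃ M) (q : Set (ParamFormula L C I)) (a b : X → C) : Prop :=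
  ∀ θ : L.Formula (X ⊕ I), θ.Realize (Sum.elim a (tuple m)) ↔ inst θ b ∈ q

theorem isShadow_of_forall_realize (hq : IsCompleteType q) {a b : X → C}
    (hab : ∀ θ : L.Formula (X ⊕ I), inst θ b ∈ q → θ.Realize (Sum.elim a (tuple m))) :
    IsShadow m q a b := by
  refine fun θ => ⟨fun hθ => ?_, hab θ⟩
  by_contra hn
  exact Formula.realize_not.1 (hab θ.not (inst_not θ b ▸ hq.not_mem_iff.2 hn)) hθ

theorem IsShadow.comp (hq : IsCompleteType q) {a b : X → C} (hab : IsShadow m q a b)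
    {Y : Type y} (e : Y → X) : IsShadow m q (a ∘ e) (b ∘ e) := by
  intro θ
  have hθ := hab (θ.relabel (Sum.map e id))
  rw [Formula.realize_relabel, Sum.elim_comp_map, Function.comp_id] at hθ
  rw [hθ]
  refine hq.mem_congr fun v => ?_
  simp only [realize_inst, Formula.realize_relabel, Sum.elim_comp_map, Function.comp_id]

theorem IsShadow.realize_iff (hq : IsCompleteType q) {a b : X → C} (hab : IsShadow m q a b)
    (χ : L.Formula X) : χ.Realize a ↔ χ.Realize b := by
  rw [← hq.inst_relabel_inl_mem_iff (b := b), ← hab, Formula.realize_relabel, Sum.elim_comp_inl]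

theorem IsShadow.exists_realize_iff [Nonempty C] (hq : IsCompleteType q) {a b : X → C}
    (hab : IsShadow m q a b) {Y : Type y} (φ : L.Formula (X ⊕ Y)) :
    (∃ v : Y → C, φ.Realize (Sum.elim a v)) ↔ ∃ v : Y → C, φ.Realize (Sum.elim b v) := by
  rw [← realize_exsRight, hab.realize_iff hq, realize_exsRight]

/-- The parameters from `M` written as variables corresponding to the enumeration `m`. -/
def paramEquiv (m : I ≃ M) (X : Type z) : M ⊕ X ≃ X ⊕ I :=
  (Equiv.sumComm M X).trans (Equiv.sumCongr (Equiv.refl X) m.symm)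

theorem elim_comp_paramEquiv {N : Type y} (a : X → N) (f : C → N) :
    Sum.elim a (f ∘ tuple m) ∘ paramEquiv m X = Sum.elim (fun c : M => f c) a := by
  ext (c | j) <;> simp [paramEquiv, tuple]

theorem isShadow_iff_mem_tp_iff (hq : IsCompleteType q) {a b : X → C} :
    IsShadow m q a b ↔ ∀ θ : ParamFormula L M X,
      θ ∈ tp (fun c : M => (c : C)) a ↔ inst (θ.relabel (paramEquiv m X)) b ∈ q := by
  have mem_tp_iff : ∀ θ : ParamFormula L M X, θ ∈ tp (fun c : M => (c : C)) a ↔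
      (θ.relabel (paramEquiv m X)).Realize (Sum.elim a (tuple m)) := fun θ => by
    rw [Formula.realize_relabel]
    exact iff_of_eq (congrArg θ.Realize (elim_comp_paramEquiv a id).symm)
  refine ⟨fun hab θ => (mem_tp_iff θ).trans (hab _), fun hab θ => ?_⟩
  have relabel_relabel : ∀ v : X ⊕ I → C,
      ((θ.relabel (paramEquiv m X).symm).relabel (paramEquiv m X)).Realize v ↔ θ.Realize v := by
    intro v
    rw [Formula.realize_relabel, Formula.realize_relabel, Function.comp_assoc,
      Equiv.self_comp_symm, Function.comp_id]
  rw [← relabel_relabel, ← mem_tp_iff, hab]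
  exact hq.mem_congr fun v => by rw [realize_inst, realize_inst, relabel_relabel]

theorem IsShadow.tp_eq (hq : IsCompleteType q) {a a' b : X → C} (hab : IsShadow m q a b)
    (hab' : IsShadow m q a' b) :
    tp (L := L) (fun c : M => (c : C)) a = tp (L := L) (fun c : M => (c : C)) a' :=
  Set.ext fun θ =>
    ((isShadow_iff_mem_tp_iff hq).1 hab θ).trans ((isShadow_iff_mem_tp_iff hq).1 hab' θ).symm

theorem exists_isShadow [Infinite I] {κ : Cardinal.{w}} (hC : IsSaturated L C κ)
    (hI : HasCardinalLT I κ) (hq : q ∈ typesAt m) (hX : HasCardinalLT X κ) (b : X → C) :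
    ∃ a : X → C, IsShadow m q a b := by
  classical
  have : Nonempty C := ⟨tuple m (Classical.arbitrary I)⟩
  have hIX := (hasCardinalLT_sum_iff I X κ (aleph0_le_of_hasCardinalLT hI)).2 ⟨hI, hX⟩
  have realize_swap : ∀ (θ : L.Formula (I ⊕ X)) (v : I → C),
      (inst (θ.relabel Sum.swap) b).Realize (Sum.elim id v) ↔ θ.Realize (Sum.elim v b) :=
    fun θ v => by rw [realize_inst, Formula.realize_relabel, Sum.elim_swap]
  obtain ⟨a, ha⟩ := hC.exists_forall_realize hIX (tuple m)
    (Γ := {θ : L.Formula (I ⊕ X) | inst (θ.relabel Sum.swap) b ∈ q}) fun s hs => by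
      let Θ : L.Formula (I ⊕ X) := Formula.iInf fun θ : s => (θ : L.Formula (I ⊕ X))
      have hΘ : (exsRight Θ).relabel Sum.inr ∈ q :=
        hq.1.mem_of_forall_realize (s := s.image fun θ => inst (θ.relabel Sum.swap) b)
          (by simpa [Set.subset_def] using hs) fun v hv => by
            rw [Formula.realize_relabel, Sum.elim_comp_inr, realize_exsRight]
            exact ⟨b, Formula.realize_iInf.2 fun θ =>
              (realize_swap _ v).1 (hv _ (Finset.mem_image_of_mem _ θ.2))⟩
      obtain ⟨v, hv⟩ := realize_exsRight.1 ((relabel_inr_mem_iff_of_mem_typesAt hq).1 hΘ)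
      exact ⟨v, fun θ hθ => Formula.realize_iInf.1 hv ⟨θ, hθ⟩⟩
  refine ⟨a, isShadow_of_forall_realize hq.1 fun θ hθ => ?_⟩
  have hθa := ha (θ.relabel Sum.swap) ((hq.1.mem_congr fun v => ?_).1 hθ)
  · rwa [Formula.realize_relabel, Sum.elim_swap] at hθa
  · rw [realize_swap, Formula.realize_relabel, Sum.elim_swap, realize_inst]

theorem IsShadow.inst_mem_congr [Infinite I] {κ : Cardinal.{w}} (hC : IsSaturated L C κ)
    (hI : HasCardinalLT I κ) (hp : p ∈ invTypesAt m) (hq : q ∈ typesAt m)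
    {Y : Type y} (hX : HasCardinalLT X κ) (hY : HasCardinalLT Y κ)
    {a b : X → C} {a' b' : Y → C} (hab : IsShadow m q a b) (hab' : IsShadow m q a' b')
    {φ : L.Formula (X ⊕ I)} {φ' : L.Formula (Y ⊕ I)}
    (hφ : ∀ v : I → C, φ.Realize (Sum.elim b v) ↔ φ'.Realize (Sum.elim b' v)) :
    inst φ a ∈ p ↔ inst φ' a' ∈ p := by
  have : Nonempty C := ⟨tuple m (Classical.arbitrary I)⟩
  obtain ⟨d, hd⟩ := exists_isShadow hC hI hq
    ((hasCardinalLT_sum_iff X Y κ (aleph0_le_of_hasCardinalLT hI)).2 ⟨hX, hY⟩) (Sum.elim b b')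
  rw [hp.2.inst_mem_iff hp.1.1 (hab.tp_eq hq.1 (hd.comp hq.1 Sum.inl)),
    hp.2.inst_mem_iff hp.1.1 (hab'.tp_eq hq.1 (hd.comp hq.1 Sum.inr))]
  let δ : L.Formula ((X ⊕ Y) ⊕ I) :=
    ((φ.relabel (Sum.map Sum.inl id)).iff (φ'.relabel (Sum.map Sum.inr id))).not
  have realize_δ : ∀ (c : X ⊕ Y → C) (v : I → C), δ.Realize (Sum.elim c v) ↔
      ¬(φ.Realize (Sum.elim (c ∘ Sum.inl) v) ↔ φ'.Realize (Sum.elim (c ∘ Sum.inr) v)) := by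
    simp [δ, Formula.realize_relabel, Sum.elim_comp_map, Formula.realize_iff]
  refine hp.1.1.mem_congr fun v => ?_
  rw [realize_inst, realize_inst]
  by_contra hne
  obtain ⟨v', hv'⟩ := (hd.exists_realize_iff hq.1 δ).1 ⟨v, (realize_δ d v).2 hne⟩
  exact (realize_δ _ v').1 hv' (hφ v')

end Shadows

section Star

variable {L : FirstOrder.Language.{u, v}} {C : Type w} [L.Structure C]
  {M : L.ElementarySubstructure C} {I : Type x} {m : I ≃ M}
  {C' : Type y} [L.Structure C'] {ι : C ↪ₑ[L] C'} {p q r : Set (ParamFormula L C I)}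

theorem mem_h_iff (hι : HasConjugates ι m) (hq : q ∈ typesAt m) {X : Type z} {b : X → C}
    {θ : ParamFormula L M X} : θ ∈ h ι m b q ↔ inst (θ.relabel (paramEquiv m X)) b ∈ q := by
  have mem_tp_iff : ∀ σ : C' ≃[L] C',
      θ ∈ tp (L := L) (fun c : M => ι (c : C)) (fun j => σ.symm (ι (b j))) ↔
        inst (θ.relabel (paramEquiv m X)) b ∈ tp (L := L) ι (fun i => σ (ι (tuple m i))) := by
    intro σ
    simp only [tp, inst, Set.mem_ofPred_eq, Formula.realize_relabel, Sum.elim_comp_map]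
    rw [← StrongHomClass.realize_formula σ]
    refine iff_of_eq (congrArg _ ?_)
    refine Eq.trans ?_ (elim_comp_paramEquiv (ι ∘ b) (σ ∘ ι)).symm
    ext (c | j) <;> simp
  refine ⟨?_, fun hθ => ?_⟩
  · rintro ⟨σ, rfl, hθ⟩
    exact (mem_tp_iff σ).1 hθ
  · obtain ⟨σ, hσ⟩ := hι q hq
    exact ⟨σ, hσ, (mem_tp_iff σ).2 (hσ ▸ hθ)⟩

theorem tp_eq_h_iff (hι : HasConjugates ι m) (hq : q ∈ typesAt m) {X : Type z} {a b : X → C} :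
    tp (L := L) (fun c : M => (c : C)) a = h ι m b q ↔ IsShadow m q a b := by
  simp only [Set.ext_iff, mem_h_iff hι hq, isShadow_iff_mem_tp_iff hq.1]

theorem relabel_inr_mem_morley_h_iff (hι : HasConjugates ι m) (hp : IsCompleteType p)
    (hq : q ∈ typesAt m) {X : Type z} {φ : L.Formula (X ⊕ I)} {b : X → C} :
    φ.relabel Sum.inr ∈ morley p (h ι m b q) ↔ ∃ a, IsShadow m q a b ∧ inst φ a ∈ p := by
  refine exists_congr fun a => and_congr (tp_eq_h_iff hι hq) (hp.mem_congr fun v => ?_)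
  simp only [inst, Formula.realize_relabel, Function.comp_assoc, Sum.elim_comp_inr]

theorem star_congr {ψ ψ' : ParamFormula L C I}
    (hψ : ∀ v : I → C, ψ.Realize (Sum.elim id v) ↔ ψ'.Realize (Sum.elim id v)) :
    ψ ∈ star ι m p q ↔ ψ' ∈ star ι m p q := by
  simp only [star, Set.mem_ofPred_eq, hψ]

variable [Infinite I] {κ : Cardinal.{w}}

theorem inst_mem_star_iff (hC : IsSaturated L C κ) (hI : HasCardinalLT I κ)
    (hι : HasConjugates ι m) (hp : p ∈ invTypesAt m) (hq : q ∈ typesAt m) {X : Type z}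
    (hX : HasCardinalLT X κ) {a b : X → C} (hab : IsShadow m q a b) {φ : L.Formula (X ⊕ I)} :
    inst φ b ∈ star ι m p q ↔ inst φ a ∈ p := by
  have : Nonempty C := ⟨tuple m (Classical.arbitrary I)⟩
  refine ⟨?_, fun hφ => ?_⟩
  · rintro ⟨φ', b', hφφ', hφ'⟩
    obtain ⟨a', hab', hφ'p⟩ := (relabel_inr_mem_morley_h_iff hι hp.1.1 hq).1 hφ'
    simp only [realize_inst] at hφφ'
    exact (hab.inst_mem_congr hC hI hp hq hX hI hab' hφφ').2 hφ'p
  · obtain ⟨b', φ', hφφ'⟩ := exists_realize_inst_iff (α := I) {inst φ b}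
    obtain ⟨a', hab'⟩ := exists_isShadow hC hI hq hI b'
    have hφφ'' := hφφ' _ (Finset.mem_singleton_self _)
    refine ⟨_, b', hφφ'', (relabel_inr_mem_morley_h_iff hι hp.1.1 hq).2 ⟨a', hab', ?_⟩⟩
    simp only [realize_inst] at hφφ''
    exact (hab.inst_mem_congr hC hI hp hq hX hI hab' hφφ'').1 hφ

theorem star_finitelySatisfiable (hC : IsSaturated L C κ) (hI : HasCardinalLT I κ)
    (hι : HasConjugates ι m) (hp : p ∈ invTypesAt m) (hq : q ∈ typesAt m)
    (s : Finset (ParamFormula L C I)) (hs : (s : Set _) ⊆ star ι m p q) :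
    ∃ v : I → C, ∀ ψ ∈ s, ψ.Realize (Sum.elim id v) := by
  classical
  have : Nonempty C := ⟨tuple m (Classical.arbitrary I)⟩
  obtain ⟨b, φ, hφ⟩ := exists_realize_inst_iff (α := I) s
  obtain ⟨a, hab⟩ := exists_isShadow hC hI hq hI b
  have inst_mem : ∀ ψ ∈ s, inst (φ ψ) a ∈ p := fun ψ hψ =>
    (inst_mem_star_iff hC hI hι hp hq hI hab).1 ((star_congr (hφ ψ hψ)).1 (hs hψ))
  obtain ⟨v, hv⟩ := hp.1.1.finitelySatisfiable (s.image fun ψ => inst (φ ψ) a)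
    (by simpa [Set.subset_def] using inst_mem)
  obtain ⟨v', hv'⟩ := (hab.exists_realize_iff hq.1 (Formula.iInf fun ψ : s => φ ψ)).1
    ⟨v, Formula.realize_iInf.2 fun ψ => realize_inst.1 (hv _ (Finset.mem_image_of_mem _ ψ.2))⟩
  exact ⟨v', fun ψ hψ =>
    (hφ ψ hψ v').2 (realize_inst.2 (Formula.realize_iInf.1 hv' ⟨ψ, hψ⟩))⟩

theorem star_complete (hC : IsSaturated L C κ) (hI : HasCardinalLT I κ)
    (hι : HasConjugates ι m) (hp : p ∈ invTypesAt m) (hq : q ∈ typesAt m)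
    (ψ : ParamFormula L C I) : ψ ∈ star ι m p q ∨ ψ.not ∈ star ι m p q := by
  have : Nonempty C := ⟨tuple m (Classical.arbitrary I)⟩
  obtain ⟨b, φ, hφ⟩ := exists_realize_inst_iff (α := I) {ψ}
  obtain ⟨a, hab⟩ := exists_isShadow hC hI hq hI b
  have hψ := hφ ψ (Finset.mem_singleton_self ψ)
  have hψ_not : ∀ v : I → C,
      ψ.not.Realize (Sum.elim id v) ↔ (inst (φ ψ).not b).Realize (Sum.elim id v) := fun v => by
    rw [inst_not, Formula.realize_not, Formula.realize_not, hψ]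
  rw [star_congr hψ, star_congr hψ_not, inst_mem_star_iff hC hI hι hp hq hI hab,
    inst_mem_star_iff hC hI hι hp hq hI hab, inst_not]
  exact hp.1.1.complete _

theorem star_mem_typesAt (hC : IsSaturated L C κ) (hI : HasCardinalLT I κ)
    (hι : HasConjugates ι m) (hp : p ∈ invTypesAt m) (hq : q ∈ typesAt m) :
    star ι m p q ∈ typesAt m := by
  refine ⟨⟨star_finitelySatisfiable hC hI hι hp hq, star_complete hC hI hι hp hq⟩, fun φ hφ => ?_⟩
  obtain ⟨a, hab⟩ := exists_isShadow hC hI hq hI (tuple m)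
  have realize_inst_inr : ∀ b v : I → C, (φ.relabel Sum.inr).Realize (Sum.elim id v) ↔
      (inst (φ.relabel Sum.inr) b).Realize (Sum.elim id v) := fun b v => by
    simp only [realize_inst, Formula.realize_relabel, Sum.elim_comp_inr]
  rw [star_congr (realize_inst_inr (tuple m)), inst_mem_star_iff hC hI hι hp hq hI hab]
  exact (hp.1.1.mem_congr (realize_inst_inr a)).1 (hp.1.2 φ hφ)

theorem star_isInvariant (hC : IsSaturated L C κ) (hI : HasCardinalLT I κ)
    (hι : HasConjugates ι m) (hp : p ∈ invTypesAt m) (hq : q ∈ invTypesAt m) :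
    IsInvariant M (star ι m p q) := by
  intro n φ b b' hbb'
  have hn : HasCardinalLT (Fin n) κ :=
    hasCardinalLT_of_finite _ κ (aleph0_le_of_hasCardinalLT hI)
  obtain ⟨a, hab⟩ := exists_isShadow hC hI hq.1 hn b
  have hab' : IsShadow m q a b' := fun θ => (hab θ).trans (hq.2 n θ b b' hbb')
  rw [inst_mem_star_iff hC hI hι hp hq.1 hn hab, inst_mem_star_iff hC hI hι hp hq.1 hn hab']

theorem IsShadow.trans (hC : IsSaturated L C κ) (hI : HasCardinalLT I κ)
    (hι : HasConjugates ι m) (hq : q ∈ invTypesAt m) (hr : r ∈ typesAt m) {X : Type z}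
    (hX : HasCardinalLT X κ) {c a b : X → C} (hca : IsShadow m q c a) (hab : IsShadow m r a b) :
    IsShadow m (star ι m q r) c b := fun θ =>
  (hca θ).trans (inst_mem_star_iff hC hI hι hq hr hX hab).symm

theorem star_assoc (hC : IsSaturated L C κ) (hI : HasCardinalLT I κ)
    (hι : HasConjugates ι m) (hp : p ∈ invTypesAt m) (hq : q ∈ invTypesAt m)
    (hr : r ∈ typesAt m) :
    star ι m (star ι m p q) r = star ι m p (star ι m q r) := by
  have : Nonempty C := ⟨tuple m (Classical.arbitrary I)⟩
  have hpq : star ι m p q ∈ invTypesAt m :=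
    ⟨star_mem_typesAt hC hI hι hp hq.1, star_isInvariant hC hI hι hp hq⟩
  have hqr : star ι m q r ∈ typesAt m := star_mem_typesAt hC hI hι hq hr
  ext ψ
  obtain ⟨b, φ, hφ⟩ := exists_realize_inst_iff (α := I) {ψ}
  have hψ := hφ ψ (Finset.mem_singleton_self ψ)
  obtain ⟨a, hab⟩ := exists_isShadow hC hI hr hI b
  obtain ⟨c, hca⟩ := exists_isShadow hC hI hq.1 hI a
  calc ψ ∈ star ι m (star ι m p q) r
    _ ↔ inst (φ ψ) b ∈ star ι m (star ι m p q) r := star_congr hψ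
    _ ↔ inst (φ ψ) a ∈ star ι m p q := inst_mem_star_iff hC hI hι hpq hr hI hab
    _ ↔ inst (φ ψ) c ∈ p := inst_mem_star_iff hC hI hι hp hq.1 hI hca
    _ ↔ inst (φ ψ) b ∈ star ι m p (star ι m q r) :=
      (inst_mem_star_iff hC hI hι hp hqr hI (hca.trans hC hI hι hq hr hI hab)).symm
    _ ↔ ψ ∈ star ι m p (star ι m q r) := (star_congr hψ).symm

end Star

end StarProduct

theorem mainTheorem10_general {L : FirstOrder.Language.{u, v}}
    {C : Type w} [L.Structure C] [Infinite C] {κ : Cardinal.{w}}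
    (hC : StarProduct.IsSaturated L C κ)
    (M : L.ElementarySubstructure C) (hM : #M < κ) {I : Type x} (m : I ≃ M)
    {C' : Type y} [L.Structure C'] {κ' : Cardinal.{y}} (hC' : StarProduct.IsMonster L C' κ')
    (ι : C ↪ₑ[L] C') (hCC' : HasCardinalLT C κ') :
    (∀ p ∈ StarProduct.invTypesAt m, ∀ q ∈ StarProduct.typesAt m,
      StarProduct.star ι m p q ∈ StarProduct.typesAt m) ∧
    (∀ p ∈ StarProduct.invTypesAt m, ∀ q ∈ StarProduct.invTypesAt m,
      StarProduct.star ι m p q ∈ StarProduct.invTypesAt m) ∧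
    (∀ p ∈ StarProduct.invTypesAt m, ∀ q ∈ StarProduct.invTypesAt m,
      ∀ r ∈ StarProduct.typesAt m,
      StarProduct.star ι m (StarProduct.star ι m p q) r =
        StarProduct.star ι m p (StarProduct.star ι m q r)) := by
  have : Infinite M := M.elementarilyEquivalent.infinite_iff.2 inferInstance
  have : Infinite I := m.infinite_iff.2 inferInstance
  have hI : HasCardinalLT I κ := (hasCardinalLT_iff_of_equiv m κ).2
    ((hasCardinalLT_iff_cardinal_mk_lt M κ).2 hM)
  have hι : StarProduct.HasConjugates ι m := hC'.hasConjugates ι hCC' m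
  exact ⟨fun p hp q hq => StarProduct.star_mem_typesAt hC hI hι hp hq,
    fun p hp q hq => ⟨StarProduct.star_mem_typesAt hC hI hι hp hq.1,
      StarProduct.star_isInvariant hC hI hι hp hq⟩,
    fun p hp q hq r hr => StarProduct.star_assoc hC hI hι hp hq hr⟩

theorem mainTheorem10 {L : FirstOrder.Language.{u, v}}
    {C : Type w} [L.Structure C] [Infinite C] {κ : Cardinal.{w}}
    (hC : StarProduct.IsMonster L C κ)
    (M : L.ElementarySubstructure C) (hM : Cardinal.mk M < κ)
    {I : Type x} (m : I ≃ M)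
    {C' : Type y} [L.Structure C'] {κ' : Cardinal.{y}}
    (hC' : StarProduct.IsMonster L C' κ')
    (ι : C ↪ₑ[L] C')
    (hCC' : Cardinal.lift.{y} (Cardinal.mk C) < Cardinal.lift.{w} κ') :
    (∀ p ∈ StarProduct.invTypesAt m, ∀ q ∈ StarProduct.invTypesAt m,
      StarProduct.star ι m p q ∈ StarProduct.invTypesAt m) ∧
    (∀ p ∈ StarProduct.invTypesAt m, ∀ q ∈ StarProduct.invTypesAt m,
      ∀ r ∈ StarProduct.invTypesAt m,
      StarProduct.star ι m (StarProduct.star ι m p q) r =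
        StarProduct.star ι m p (StarProduct.star ι m q r)) := by
  obtain ⟨-, star_mem, star_assoc⟩ := mainTheorem10_general hC.saturated M hM m hC' ι hCC'
  exact ⟨star_mem, fun p hp q hq r hr => star_assoc p hp q hq r hr.1⟩
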